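/- Let $\mu$ be a probability measure and let $(Z^{\lambda})_{\lambda\in\Lambda}$ be real random variables in $L^2_\mu$, functions of a random input with law $\mu$; write $E$ and $V$ for their expectation and variance. For realizations $x_1,x_2,\dots$ put $$E_M(x)=\frac1M\sum_{m=1}^M x_m,\qquad V_M(x)=\frac1{M-1}\sum_{m=1}^M\Big|x_m-\frac{m-1}{m}E_m(x)\Big|^2 ,$$ and let $\operatorname{erf}(x)=\frac{2}{\sqrt\pi}\int_0^x e^{-t^2}\,dt$. Fix $I\in\mathbb N$ and parameters $\lambda,\lambda_1,\dots,\lambda_I\in\Lambda$ with $V(Z^{\lambda_i})\neq0$ for all $i$. All Monte Carlo realizations live on one probability space with probability $P$, as follows. (1) For each $i$ the means $E_{M_{\rm large}}(Z^{\lambda_i})$ and the variance estimators $V_{M_{\rm large}}(Z^{\lambda_i})$ are computed from $M_{\rm large}$ i.i.d. realizations of $Z^{\lambda_i}$; the samples used for different $i$ are independent of one another. (2) The coefficients $\tilde\alpha^\lambda=(\tilde\alpha_1^\lambda,\dots,\tilde\alpha_I^\lambda)$ are real random variables, which may depend on $M_{\rm large}$ and on the large samples. (3) The $M_{\rm test}$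 i.i.d. test realizations $(Z^\lambda_m,Z^{\lambda_1}_m,\dots,Z^{\lambda_I}_m)$, $m=1,\dots,M_{\rm test}$, computed from common random inputs with law $\mu$, are jointly independent of all the large samples and all the coefficients. (4) Almost surely, as $M_{\rm large}\to\infty$, $\tilde\alpha^\lambda$ stays bounded and $V\big(Z^\lambda-\sum_i\alpha_iZ^{\lambda_i}\big)\big|_{\alpha=\tilde\alpha^\lambda}$ stays bounded away from $0$. (If $\tilde\alpha^\lambda$ does not depend on $M_{\rm large}$, this only says that this variance is almost surely nonzero.) Let $\tilde Y^i=Z^{\lambda_i}-E_{M_{\rm large}}(Z^{\lambda_i})$ and $\hat Y^\lambda=\sum_{i=1}^I\tilde\alpha_i^\lambda\tilde Y^i$. Let $E_{M_{\rm test}}(Z^\lambda-\hat Y^\lambda)$ and $V_{M_{\rm test}}(Z^\lambda-\hat Y^\lambda)$ be the estimators above, computed from the test realizations of $Z^\lambda-\hat Y^\lambda$, and write $E(\tilde Y^i)=E(Z^{\lambda_i})-E_{M_{\rm large}}(Z^{\lambda_i})$. For $a,a_1,\dots,a_I>0$ consider the events $$A=\Big\{\Big|E_{M_{\rm test}}(Z^\lambda-\hat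 Y^\lambda)-E(Z^\lambda)+\sum_{i=1}^I\tilde\alpha_i^\lambda E(\tilde Y^i)\Big|\le a\sqrt{V_{M_{\rm test}}(Z^\lambda-\hat Y^\lambda)/M_{\rm test}}\Big\},$$ $$B=\bigcap_{i=1}^I\Big\{\big|E(Z^{\lambda_i})-E_{M_{\rm large}}(Z^{\lambda_i})\big|\le a_i\sqrt{V_{M_{\rm large}}(Z^{\lambda_i})/M_{\rm large}}\Big\},$$ $$C=\Big\{\big|E_{M_{\rm test}}(Z^\lambda-\hat Y^\lambda)-E(Z^\lambda)\big|\le a\sqrt{\frac{V_{M_{\rm test}}(Z^\lambda-\hat Y^\lambda)}{M_{\rm test}}}+\sum_{i=1}^I|\tilde\alpha_i^\lambda|\,a_i\sqrt{\frac{V_{M_{\rm large}}(Z^{\lambda_i})}{M_{\rm large}}}\Big\}.$$ Then, as $M_{\rm large}\ge M_{\rm test}\to\infty$: (i) the conditional probability of $A$ given the means $E_{M_{\rm large}}(Z^{\lambda_i})$, $i=1,\dots,I$, and the coefficients $\tilde\alpha^\lambda$ converges almost surely to $\operatorname{erf}(a/\sqrt2)$; (ii) $P(A\cap B)\to\operatorname{erf}\!\big(\tfrac{a}{\sqrt2}\big)\prod_{i=1}^I\operatorname{erf}\!\big(\tfrac{a_i}{\sqrt2}\big)$;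 (iii) $A\cap B\subseteq C$ for all $M_{\rm large},M_{\rm test}$, and hence $$\liminf_{M_{\rm large}\ge M_{\rm test}\to\infty}P(C)\ \ge\ \operatorname{erf}\!\Big(\frac{a}{\sqrt2}\Big)\prod_{i=1}^I\operatorname{erf}\!\Big(\frac{a_i}{\sqrt2}\Big).$$ -/

import Mathlib

open MeasureTheory ProbabilityTheory Filter Topology

noncomputable section

/-- The error function `erf x = (2 / √π) ∫₀ˣ exp (-t²) dt`. -/
def erf (x : ℝ) : ℝ :=
  2 / Real.sqrt Real.pi * ∫ t in (0 : ℝ)..x, Real.exp (-t ^ 2)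

/-- The Monte Carlo mean `E_M(x) = (1/M) ∑_{m=1}^M x_m`.
The realizations `x_1, x_2, …` are stored as `x 0, x 1, …`. -/
def mcMean (M : ℕ) (x : ℕ → ℝ) : ℝ :=
  (∑ m ∈ Finset.range M, x m) / (M : ℝ)

/-- The Monte Carlo variance estimator
`V_M(x) = (1/(M-1)) ∑_{m=1}^M |x_m - ((m-1)/m) E_m(x)|²`.
As `x 0` is the first realization, the summation index below is one less than in this formula. -/
def mcVar (M : ℕ) (x : ℕ → ℝ) : ℝ :=
  (∑ m ∈ Finset.range M,
    (x m - (m : ℝ) / ((m : ℝ) + 1) * mcMean (m + 1) x) ^ 2) / ((M : ℝ) - 1)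

/-- The realizations `Z^l_m - ∑ i, α i * (Z^{lam i}_m - c i)`, `m = 1, 2, …`, of `Z^l` minus its
control variate, computed from the same random inputs `ξ 0, ξ 1, …` for all parameter values;
`c i` is the precomputed approximation of the mean of `Z^{lam i}`. -/
def rbSample {Λ X : Type*} {I : ℕ} (Z : Λ → X → ℝ) (l : Λ) (lam : Fin I → Λ)
    (α c : Fin I → ℝ) (ξ : ℕ → X) : ℕ → ℝ :=
  fun m => Z l (ξ m) - ∑ i, α i * (Z (lam i) (ξ m) - c i)

/-- The precomputed large-sample means `E_L(Z^{lam i})`, where the `i`-th mean uses the random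
inputs `η i 0, …, η i (L-1)`. -/
def largeMeans {Λ X : Type*} {I : ℕ} (Z : Λ → X → ℝ) (lam : Fin I → Λ) (L : ℕ)
    (η : Fin I → ℕ → X) : Fin I → ℝ :=
  fun i => mcMean L (fun m => Z (lam i) (η i m))

/-- The reduced-basis control-variate estimator `E_T(Z^l - Ŷ^l)`. -/
def rbMean {Λ X : Type*} {I : ℕ} (Z : Λ → X → ℝ) (l : Λ) (lam : Fin I → Λ)
    (α c : Fin I → ℝ) (ξ : ℕ → X) (T : ℕ) : ℝ :=
  mcMean T (rbSample Z l lam α c ξ)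

/-- The variance estimator `V_T(Z^l - Ŷ^l)`, from the same realizations as `rbMean`. -/
def rbVar {Λ X : Type*} {I : ℕ} (Z : Λ → X → ℝ) (l : Λ) (lam : Fin I → Λ)
    (α c : Fin I → ℝ) (ξ : ℕ → X) (T : ℕ) : ℝ :=
  mcVar T (rbSample Z l lam α c ξ)

/-- The event that the bias-corrected error of the estimator is within its confidence interval:
`|E_T(Z^l - Ŷ^l) - E(Z^l) + ∑ i, α i * E(Ỹ^i)| ≤ a √(V_T(Z^l - Ŷ^l) / T)`, where
`E(Ỹ^i) = E(Z^{lam i}) - E_L(Z^{lam i})`. -/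
def testEvent {Λ X Ω : Type*} [MeasurableSpace X] (μ : Measure X) {I : ℕ} (Z : Λ → X → ℝ)
    (l : Λ) (lam : Fin I → Λ) (α : ℕ → Ω → Fin I → ℝ) (η : Fin I → ℕ → Ω → X)
    (ξ : ℕ → Ω → X) (a : ℝ) (L T : ℕ) : Set Ω :=
  {ω | |rbMean Z l lam (α L ω) (largeMeans Z lam L (fun i m => η i m ω)) (fun m => ξ m ω) T
          - (∫ x, Z l x ∂μ)
          + ∑ i, α L ω i *
              ((∫ x, Z (lam i) x ∂μ) - largeMeans Z lam L (fun j m => η j m ω) i)|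
      ≤ a * Real.sqrt (rbVar Z l lam (α L ω) (largeMeans Z lam L (fun i m => η i m ω))
          (fun m => ξ m ω) T / (T : ℝ))}

/-- The event that all precomputed means are within their confidence intervals:
`|E(Z^{lam i}) - E_L(Z^{lam i})| ≤ a_i √(V_L(Z^{lam i}) / L)` for every `i`. -/
def largeEvent {Λ X Ω : Type*} [MeasurableSpace X] (μ : Measure X) {I : ℕ} (Z : Λ → X → ℝ)
    (lam : Fin I → Λ) (η : Fin I → ℕ → Ω → X) (b : Fin I → ℝ) (L : ℕ) : Set Ω :=
  {ω | ∀ i, |(∫ x, Z (lam i) x ∂μ) - largeMeans Z lam L (fun j m => η j m ω) i|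
      ≤ b i * Real.sqrt (mcVar L (fun m => Z (lam i) (η i m ω)) / (L : ℝ))}

/-- The event of the full error bound
`|E_T(Z^l - Ŷ^l) - E(Z^l)|
  ≤ a √(V_T(Z^l - Ŷ^l) / T) + ∑ i, |α i| a_i √(V_L(Z^{lam i}) / L)`. -/
def boundEvent {Λ X Ω : Type*} [MeasurableSpace X] (μ : Measure X) {I : ℕ} (Z : Λ → X → ℝ)
    (l : Λ) (lam : Fin I → Λ) (α : ℕ → Ω → Fin I → ℝ) (η : Fin I → ℕ → Ω → X)
    (ξ : ℕ → Ω → X) (a : ℝ) (b : Fin I → ℝ) (L T : ℕ) : Set Ω :=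
  {ω | |rbMean Z l lam (α L ω) (largeMeans Z lam L (fun i m => η i m ω)) (fun m => ξ m ω) T
          - (∫ x, Z l x ∂μ)|
      ≤ a * Real.sqrt (rbVar Z l lam (α L ω) (largeMeans Z lam L (fun i m => η i m ω))
          (fun m => ξ m ω) T / (T : ℝ))
        + ∑ i, |α L ω i| *
            (b i * Real.sqrt (mcVar L (fun m => Z (lam i) (η i m ω)) / (L : ℝ)))}

/-- The σ-algebra generated by the precomputed means `E_L(Z^{lam i})` and the coefficients. -/
abbrev precomputedSigma {Λ X Ω : Type*} {I : ℕ} (Z : Λ → X → ℝ) (lam : Fin I → Λ)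
    (α : ℕ → Ω → Fin I → ℝ) (η : Fin I → ℕ → Ω → X) (L : ℕ) : MeasurableSpace Ω :=
  MeasurableSpace.comap
    (fun ω => (largeMeans Z lam L (fun i m => η i m ω), α L ω)) inferInstance

/-- The limit `M_large ≥ M_test → ∞`, for pairs `(M_large, M_test)`. -/
def largeGeTest : Filter (ℕ × ℕ) :=
  (atTop ×ˢ atTop) ⊓ 𝓟 {p : ℕ × ℕ | p.2 ≤ p.1}

end

/-!
The argument rests on one fact: since the test inputs are independent of everything precomputed,
conditioning the test event on the means and the coefficients amounts to freezing the values of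
these (`condExp_indicator_of_indepFun`). For frozen coefficients `α` and means `c` the test event
says that the Monte Carlo mean of the single random variable
`rbVariable = Z^l - ∑ i, α i * (Z^{lam i} - c i)` lies within its studentized confidence interval
(`testEvent_eq_confidenceEvent`), and the probability of this tends to `erf (a / √2)`.

As the frozen values change with the size `L` of the large samples, this limit is needed locally
uniformly in `α` and `c`. It is proved for integrands `f n` that converge to `f` in `L²`
(`tendsto_confidenceEvent`). For the fixed integrand `f`, the central limit theorem, the consistency
of the variance estimator (`tendsto_mcVar`) and Slutsky's theorem give the limit. Replacing `f` by
`f n` changes the normalized error and the estimated standard deviation by terms that tend to `0` in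
probability: both have second moments controlled by `‖f n - f‖²` uniformly in the sample size
(`integral_normalizedError_sq_le`, `integral_mcVar_le`), and the estimated standard deviation is a
seminorm (`abs_sqrt_mcVar_sub_le`). Almost surely the coefficients are bounded, the variances stay
away from `0`, and the means converge by the strong law of large numbers, so a compactness argument
gives the almost sure limit of the conditional probabilities (`tendsto_confidenceEvent_rbVariable`).

For the joint event, Fubini's theorem writes its probability as the integral over the large-sample
event of the coverage probability with frozen data
(`measureReal_inter_preimage_of_indepFun`). The integrand tends to the constant `erf (a / √2)`
boundedly, and the probability of the large-sample event tends to the product of the remaining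
factors by independence (`tendsto_measureReal_largeEvent`). The inclusion in the bound event is the
triangle inequality.
-/

/-! ### The variance estimator along a sequence of realizations -/

/-- The deviation `x_m - ((m-1)/m) E_m(x)` whose squares are summed in `mcVar`; with the indexing
from `0` used there, `x m` is the realization number `m + 1`. -/
noncomputable def mcResidual (x : ℕ → ℝ) (m : ℕ) : ℝ :=
  x m - (m : ℝ) / ((m : ℝ) + 1) * mcMean (m + 1) x

lemma mcVar_eq_sum_mcResidual (M : ℕ) (x : ℕ → ℝ) :
    mcVar M x = (∑ m ∈ Finset.range M, mcResidual x m ^ 2) / ((M : ℝ) - 1) := rfl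

lemma mcMean_sub (M : ℕ) (x y : ℕ → ℝ) :
    mcMean M (fun m => x m - y m) = mcMean M x - mcMean M y := by
  simp [mcMean, Finset.sum_sub_distrib, sub_div]

lemma mcResidual_sub (x y : ℕ → ℝ) (m : ℕ) :
    mcResidual (fun k => x k - y k) m = mcResidual x m - mcResidual y m := by
  simp only [mcResidual, mcMean_sub]
  ring

lemma mcMean_sq_le (M : ℕ) (x : ℕ → ℝ) : mcMean M x ^ 2 ≤ mcMean M (fun m => x m ^ 2) := by
  rcases Nat.eq_zero_or_pos M with rfl | hM
  · simp [mcMean]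
  · have hM' : (0 : ℝ) < M := by exact_mod_cast hM
    have h := sq_sum_le_card_mul_sum_sq (s := Finset.range M) (f := x)
    rw [Finset.card_range] at h
    rw [mcMean, mcMean, div_pow, div_le_div_iff₀ (by positivity) hM']
    nlinarith

lemma mcResidual_sq_le (x : ℕ → ℝ) (m : ℕ) :
    mcResidual x m ^ 2 ≤ 2 * x m ^ 2 + 2 * mcMean (m + 1) (fun k => x k ^ 2) := by
  have h1 := mcMean_sq_le (m + 1) x
  have hr : (0 : ℝ) ≤ (m : ℝ) / ((m : ℝ) + 1) := by positivity
  have hr1 : (m : ℝ) / ((m : ℝ) + 1) ≤ 1 := by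
    rw [div_le_one (by positivity)]; linarith
  have hr2 : ((m : ℝ) / ((m : ℝ) + 1)) ^ 2 ≤ 1 := pow_le_one₀ hr hr1
  have h2 : ((m : ℝ) / ((m : ℝ) + 1) * mcMean (m + 1) x) ^ 2 ≤ mcMean (m + 1) x ^ 2 := by
    rw [mul_pow]; nlinarith [sq_nonneg (mcMean (m + 1) x)]
  rw [mcResidual]
  nlinarith [sq_nonneg (x m + (m : ℝ) / ((m : ℝ) + 1) * mcMean (m + 1) x)]

/-- `x ↦ √(V_M(x))` is a seminorm on the realizations, hence Lipschitz with respect to itself. -/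
lemma abs_sqrt_mcVar_sub_le (M : ℕ) (x y : ℕ → ℝ) :
    |√(mcVar M x) - √(mcVar M y)| ≤ √(mcVar M (fun m => x m - y m)) := by
  have key : ∀ z : ℕ → ℝ, √(mcVar M z)
      = ‖WithLp.toLp 2 (fun m : Fin M => mcResidual z m)‖ / √((M : ℝ) - 1) := by
    intro z
    rw [EuclideanSpace.norm_eq, mcVar_eq_sum_mcResidual, Finset.sum_range,
      Real.sqrt_div (Finset.sum_nonneg fun _ _ => sq_nonneg _)]
    simp
  rw [key, key, key, ← sub_div, abs_div, abs_of_nonneg (Real.sqrt_nonneg _)]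
  refine div_le_div_of_nonneg_right ((abs_norm_sub_norm_le _ _).trans_eq ?_) (Real.sqrt_nonneg _)
  rw [← WithLp.toLp_sub]
  congr 2
  funext m
  exact (mcResidual_sub x y m).symm

lemma tendsto_natCast_div_add_one : Tendsto (fun m : ℕ => (m : ℝ) / ((m : ℝ) + 1)) atTop (𝓝 1) :=
  tendsto_natCast_div_add_atTop 1

/-- Consistency of the variance estimator along one sequence of realizations: the recentering by
`((m-1)/m) E_m(x)` is asymptotically a recentering by the limit `e` of the means. -/
lemma tendsto_mcVar {x : ℕ → ℝ} {e s : ℝ} (he : Tendsto (fun M => mcMean M x) atTop (𝓝 e))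
    (hs : Tendsto (fun M => mcMean M (fun m => x m ^ 2)) atTop (𝓝 s)) :
    Tendsto (fun M => mcVar M x) atTop (𝓝 (s - e ^ 2)) := by
  set c : ℕ → ℝ := fun m => (m : ℝ) / ((m : ℝ) + 1) * mcMean (m + 1) x with hc
  have hcl : Tendsto (fun m => (c m - e) ^ 2) atTop (𝓝 0) := by
    have h1 : Tendsto c atTop (𝓝 (1 * e)) :=
      tendsto_natCast_div_add_one.mul (he.comp (tendsto_add_atTop_nat 1))
    simpa using (h1.sub_const e).pow 2
  have hces : Tendsto (fun M => mcMean M (fun m => (c m - e) ^ 2)) atTop (𝓝 0) := by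
    simpa [mcMean, div_eq_inv_mul] using hcl.cesaro
  have hvar : Tendsto (fun M => mcMean M (fun m => (x m - e) ^ 2)) atTop (𝓝 (s - e ^ 2)) := by
    have h1 : Tendsto (fun M => mcMean M (fun m => x m ^ 2) - 2 * e * mcMean M x + e ^ 2)
        atTop (𝓝 (s - 2 * e * e + e ^ 2)) := (hs.sub (he.const_mul _)).add_const _
    have h2 : s - 2 * e * e + e ^ 2 = s - e ^ 2 := by ring
    rw [h2] at h1
    refine h1.congr' ?_
    filter_upwards [eventually_gt_atTop 0] with M hM
    have hM' : (M : ℝ) ≠ 0 := by exact_mod_cast hM.ne'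
    have h3 : ∑ m ∈ Finset.range M, (x m - e) ^ 2
        = ∑ m ∈ Finset.range M, x m ^ 2 - 2 * e * ∑ m ∈ Finset.range M, x m + M * e ^ 2 := by
      rw [Finset.mul_sum, ← Finset.sum_sub_distrib]
      have : (M : ℝ) * e ^ 2 = ∑ _m ∈ Finset.range M, e ^ 2 := by simp
      rw [this, ← Finset.sum_add_distrib]
      exact Finset.sum_congr rfl fun m _ => by ring
    simp only [mcMean, h3]
    field_simp
  -- the mixed term is controlled by the Cauchy-Schwarz inequality
  have hmix : Tendsto (fun M => mcMean M (fun m => (x m - e) * (c m - e))) atTop (𝓝 0) := by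
    have hsq : Tendsto (fun M => √(mcMean M (fun m => (x m - e) ^ 2)
        * mcMean M (fun m => (c m - e) ^ 2))) atTop (𝓝 0) := by
      simpa using (hvar.mul hces).sqrt
    refine squeeze_zero_norm (fun M => ?_) hsq
    refine Real.abs_le_sqrt ?_
    simp only [mcMean, div_pow]
    rw [div_mul_div_comm, ← pow_two]
    exact div_le_div_of_nonneg_right (Finset.sum_mul_sq_le_sq_mul_sq _ _ _) (by positivity)
  have hres : Tendsto (fun M => mcMean M (fun m => mcResidual x m ^ 2)) atTop (𝓝 (s - e ^ 2)) := by
    have h1 := (hvar.sub (hmix.const_mul 2)).add hces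
    simp only [mul_zero, sub_zero, add_zero] at h1
    refine h1.congr fun M => ?_
    simp only [mcMean]
    rw [mul_div_assoc', Finset.mul_sum, ← sub_div, ← add_div, ← Finset.sum_sub_distrib,
      ← Finset.sum_add_distrib]
    refine congrArg (· / (M : ℝ)) (Finset.sum_congr rfl fun m _ => ?_)
    simp only [mcResidual, hc]
    ring
  have hfac : Tendsto (fun M : ℕ => (M : ℝ) / ((M : ℝ) - 1)) atTop (𝓝 1) := by
    have h := tendsto_natCast_div_add_atTop (𝕜 := ℝ) (-1)
    simpa [sub_eq_add_neg] using h
  have hfin := hfac.mul hres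
  rw [one_mul] at hfin
  refine hfin.congr' ?_
  filter_upwards [eventually_gt_atTop 1] with M hM
  have hM' : (M : ℝ) ≠ 0 := by positivity
  rw [mcVar_eq_sum_mcResidual, mcMean]
  field_simp

/-! ### The error function and the normal distribution -/

/-- The error function in terms of the normal distribution. -/
lemma gaussianReal_real_abs_le {v : NNReal} (hv : v ≠ 0) {a : ℝ} (ha : 0 < a) :
    (gaussianReal 0 v).real {x | |x| ≤ a * √v} = erf (a / √2) := by
  have hv' : (0 : ℝ) < v := by positivity
  set s : ℝ := √(2 * v) with hs
  have hs0 : 0 < s := by positivity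
  have hsq : s ^ 2 = 2 * v := Real.sq_sqrt (by positivity)
  have hset : {x : ℝ | |x| ≤ a * √v} = Set.Icc (-(a * √v)) (a * √v) := by
    ext x; simp [abs_le]
  have hle : -(a * √v) ≤ a * √v := by
    have : 0 ≤ a * √v := by positivity
    linarith
  have hend : a * √v / s = a / √2 := by
    rw [hs, Real.sqrt_mul (by norm_num)]
    field_simp
  rw [hset, measureReal_def, gaussianReal_apply_eq_integral 0 hv, ENNReal.toReal_ofReal
    (integral_nonneg fun x => gaussianPDFReal_nonneg 0 v x), integral_Icc_eq_integral_Ioc,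
    ← intervalIntegral.integral_of_le hle]
  have hpdf : ∀ x, gaussianPDFReal 0 v x = (√(2 * Real.pi * v))⁻¹ * Real.exp (-(x / s) ^ 2) := by
    intro x
    rw [gaussianPDFReal, sub_zero, div_pow, hsq, neg_div]
  simp_rw [hpdf]
  rw [intervalIntegral.integral_const_mul,
    intervalIntegral.integral_comp_div (fun t => Real.exp (-t ^ 2)) hs0.ne', neg_div, hend]
  have hint : ∀ p q : ℝ, IntervalIntegrable (fun t => Real.exp (-t ^ 2)) volume p q :=
    fun p q => (by fun_prop : Continuous fun t : ℝ => Real.exp (-t ^ 2)).intervalIntegrable _ _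
  have heven : ∫ t in -(a / √2)..0, Real.exp (-t ^ 2) = ∫ t in 0..(a / √2), Real.exp (-t ^ 2) := by
    have h := intervalIntegral.integral_comp_neg (a := 0) (b := a / √2)
      (fun t => Real.exp (-t ^ 2))
    simp only [neg_zero, even_two.neg_pow] at h
    exact h.symm
  rw [← intervalIntegral.integral_add_adjacent_intervals (hint _ 0) (hint 0 _), heven, erf,
    smul_eq_mul]
  have hc : (√(2 * Real.pi * v))⁻¹ * s = 1 / √Real.pi := by
    rw [hs, show 2 * Real.pi * (v : ℝ) = (2 * v) * Real.pi by ring,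
      Real.sqrt_mul (by positivity)]
    field_simp
  linear_combination (2 * ∫ t in 0..(a / √2), Real.exp (-t ^ 2)) * hc

/-! ### The studentized central limit theorem -/

/-- The law on the space of sequences of an i.i.d. sequence of random inputs with law `μ`. -/
noncomputable abbrev iidLaw {X : Type*} [MeasurableSpace X] (μ : Measure X)
    [IsProbabilityMeasure μ] : Measure (ℕ → X) :=
  Measure.infinitePi fun _ => μ

lemma measurable_mcMean_comp {β : Type*} [MeasurableSpace β] {x : β → ℕ → ℝ}
    (hx : ∀ m, Measurable fun ω => x ω m) (M : ℕ) : Measurable fun ω => mcMean M (x ω) := by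
  unfold mcMean
  fun_prop

lemma measurable_mcVar_comp {β : Type*} [MeasurableSpace β] {x : β → ℕ → ℝ}
    (hx : ∀ m, Measurable fun ω => x ω m) (M : ℕ) : Measurable fun ω => mcVar M (x ω) := by
  have h := measurable_mcMean_comp hx
  unfold mcVar
  fun_prop

lemma mcVar_nonneg (M : ℕ) (x : ℕ → ℝ) : 0 ≤ mcVar M x := by
  rcases Nat.eq_zero_or_pos M with rfl | hM
  · simp [mcVar]
  · have : (1 : ℝ) ≤ M := by exact_mod_cast hM
    exact div_nonneg (Finset.sum_nonneg fun _ _ => sq_nonneg _) (by linarith)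

section Iid

variable {X : Type*} [MeasurableSpace X] {μ : Measure X} {f g : X → ℝ}

/-- The normalized error `√M (E_M(f) - E(f))` of the Monte Carlo mean. -/
noncomputable def normalizedError (μ : Measure X) (f : X → ℝ) (M : ℕ) (x : ℕ → X) : ℝ :=
  (√M)⁻¹ * (∑ k ∈ Finset.range M, f (x k) - M * ∫ y, f y ∂μ)

lemma measurable_normalizedError (hf : Measurable f) (M : ℕ) :
    Measurable (normalizedError μ f M) := by
  unfold normalizedError
  fun_prop

lemma normalizedError_sub (hf : Integrable f μ) (hg : Integrable g μ) (M : ℕ) (x : ℕ → X) :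
    normalizedError μ (fun y => f y - g y) M x
      = normalizedError μ f M x - normalizedError μ g M x := by
  simp only [normalizedError, integral_sub hf hg, Finset.sum_sub_distrib]
  ring

/-- The event, in the space of sequences of inputs, that the error of the Monte Carlo mean of `f`
is at most `a` times the estimated standard deviation of this mean. -/
def confidenceEvent (μ : Measure X) (f : X → ℝ) (a : ℝ) (M : ℕ) : Set (ℕ → X) :=
  {x | |mcMean M (fun m => f (x m)) - ∫ y, f y ∂μ| ≤ a * √(mcVar M (fun m => f (x m)) / M)}

/-- The confidence event as a closed condition on a continuous function of the normalized error and
the estimated standard deviation, the form in which Slutsky's theorem applies. -/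
lemma mem_confidenceEvent_iff {a : ℝ} {M : ℕ} (hM : 0 < M) (x : ℕ → X) :
    x ∈ confidenceEvent μ f a M
      ↔ |normalizedError μ f M x| - a * √(mcVar M fun m => f (x m)) ≤ 0 := by
  have hM' : (0 : ℝ) < M := by exact_mod_cast hM
  have hs : 0 < √(M : ℝ) := by positivity
  have h1 : normalizedError μ f M x = √M * (mcMean M (fun m => f (x m)) - ∫ y, f y ∂μ) := by
    rw [normalizedError, mcMean]
    have h2 : √(M : ℝ) * √M = M := Real.mul_self_sqrt hM'.le
    field_simp
    rw [pow_two, h2]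
  rw [h1, abs_mul, abs_of_pos hs, sub_nonpos, confidenceEvent, Set.mem_ofPred_eq,
    Real.sqrt_div' _ hM'.le, mul_div_assoc', le_div_iff₀' hs]

lemma measurableSet_confidenceEvent (hf : Measurable f) (a : ℝ) (M : ℕ) :
    MeasurableSet (confidenceEvent μ f a M) := by
  have h1 := measurable_mcMean_comp (x := fun (x : ℕ → X) m => f (x m)) (by fun_prop) M
  have h2 := measurable_mcVar_comp (x := fun (x : ℕ → X) m => f (x m)) (by fun_prop) M
  exact measurableSet_le (by fun_prop) (by fun_prop)

variable [IsProbabilityMeasure μ]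

lemma measurePreserving_eval_iidLaw (m : ℕ) :
    MeasurePreserving (fun x : ℕ → X => x m) (iidLaw μ) μ :=
  measurePreserving_eval_infinitePi (fun _ => μ) m

lemma identDistrib_eval_iidLaw (hf : Measurable f) (m : ℕ) :
    IdentDistrib (fun x : ℕ → X => f (x m)) f (iidLaw μ) μ :=
  (IdentDistrib.mk (measurable_pi_apply m).aemeasurable aemeasurable_id
    (by rw [(measurePreserving_eval_iidLaw (μ := μ) m).map_eq]; exact Measure.map_id.symm) :
      IdentDistrib (fun x : ℕ → X => x m) (id : X → X) (iidLaw μ) μ).comp hf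

lemma integral_eval_iidLaw (hf : Measurable f) (m : ℕ) :
    ∫ x, f (x m) ∂iidLaw μ = ∫ y, f y ∂μ :=
  (identDistrib_eval_iidLaw hf m).integral_eq

lemma iIndepFun_eval_iidLaw (hf : Measurable f) :
    iIndepFun (fun m (x : ℕ → X) => f (x m)) (iidLaw μ) :=
  iIndepFun_infinitePi (X := fun _ => f) (fun _ => hf)

lemma ae_tendsto_mcMean (hf : Measurable f) (hfi : Integrable f μ) :
    ∀ᵐ x ∂iidLaw μ, Tendsto (fun M => mcMean M fun m => f (x m)) atTop (𝓝 (∫ y, f y ∂μ)) := by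
  have h := strong_law_ae_real (μ := iidLaw μ) (fun m x => f (x m))
    ((identDistrib_eval_iidLaw hf 0).integrable_iff.2 hfi)
    (fun i j hij => (iIndepFun_eval_iidLaw hf).indepFun hij)
    (fun i => (identDistrib_eval_iidLaw hf i).trans (identDistrib_eval_iidLaw hf 0).symm)
  rw [integral_eval_iidLaw hf] at h
  exact h

lemma ae_tendsto_mcVar (hf : Measurable f) (hf2 : MemLp f 2 μ) :
    ∀ᵐ x ∂iidLaw μ, Tendsto (fun M => mcVar M fun m => f (x m)) atTop (𝓝 Var[f; μ]) := by
  filter_upwards [ae_tendsto_mcMean hf (hf2.integrable (by norm_num)),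
    ae_tendsto_mcMean (hf.pow_const 2) hf2.integrable_sq] with x h1 h2
  have h := tendsto_mcVar h1 h2
  rwa [variance_eq_sub hf2]

lemma integral_mcMean (hf : Measurable f) (hfi : Integrable f μ) {M : ℕ} (hM : M ≠ 0) :
    ∫ x, mcMean M (fun m => f (x m)) ∂iidLaw μ = ∫ y, f y ∂μ := by
  simp only [mcMean]
  rw [integral_div, integral_finsetSum _
    fun m _ => (identDistrib_eval_iidLaw hf m).integrable_iff.2 hfi]
  simp_rw [integral_eval_iidLaw hf]
  have : (M : ℝ) ≠ 0 := by exact_mod_cast hM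
  simp [this]

lemma integrable_mcMean (hf : Measurable f) (hfi : Integrable f μ) (M : ℕ) :
    Integrable (fun x : ℕ → X => mcMean M (fun m => f (x m))) (iidLaw μ) :=
  (integrable_finsetSum _
    fun m _ => (identDistrib_eval_iidLaw hf m).integrable_iff.2 hfi).div_const _

lemma integrable_mcResidual_bound (hf : Measurable f) (hf2 : MemLp f 2 μ) (m : ℕ) :
    Integrable (fun x : ℕ → X => 2 * f (x m) ^ 2 + 2 * mcMean (m + 1) (fun k => f (x k) ^ 2))
      (iidLaw μ) :=
  (((identDistrib_eval_iidLaw (hf.pow_const 2) m).integrable_iff.2 hf2.integrable_sq).const_mul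
    2).add ((integrable_mcMean (hf.pow_const 2) hf2.integrable_sq (m + 1)).const_mul 2)

lemma integrable_mcResidual_sq (hf : Measurable f) (hf2 : MemLp f 2 μ) (m : ℕ) :
    Integrable (fun x : ℕ → X => mcResidual (fun k => f (x k)) m ^ 2) (iidLaw μ) := by
  refine (integrable_mcResidual_bound hf hf2 m).mono' ?_ (ae_of_all _ fun x => ?_)
  · have h := measurable_mcMean_comp (x := fun (x : ℕ → X) k => f (x k)) (by fun_prop) (m + 1)
    unfold mcResidual
    exact Measurable.aestronglyMeasurable (by fun_prop)
  · rw [Real.norm_of_nonneg (sq_nonneg _)]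
    exact mcResidual_sq_le _ m

lemma integrable_mcVar (hf : Measurable f) (hf2 : MemLp f 2 μ) (M : ℕ) :
    Integrable (fun x : ℕ → X => mcVar M (fun k => f (x k))) (iidLaw μ) :=
  (integrable_finsetSum _ fun m _ => integrable_mcResidual_sq hf hf2 m).div_const _

/-- The variance estimator is bounded in mean by the second moment, uniformly in the number of
realizations. -/
lemma integral_mcVar_le (hf : Measurable f) (hf2 : MemLp f 2 μ) (M : ℕ) :
    ∫ x, mcVar M (fun k => f (x k)) ∂iidLaw μ ≤ 8 * ∫ y, f y ^ 2 ∂μ := by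
  have hnn : 0 ≤ ∫ y, f y ^ 2 ∂μ := integral_nonneg fun _ => sq_nonneg _
  rcases Nat.lt_or_ge M 2 with hM | hM
  -- for `M ≤ 1` the sum in `mcVar` is empty or is divided by `0`
  · have h0 : ∀ x, mcVar M x = 0 := by
      intro x
      interval_cases M <;> simp [mcVar]
    simp only [h0, integral_zero]
    positivity
  · have hM' : (2 : ℝ) ≤ M := by exact_mod_cast hM
    have hres : ∀ m, ∫ x, mcResidual (fun k => f (x k)) m ^ 2 ∂iidLaw μ ≤ 4 * ∫ y, f y ^ 2 ∂μ := by
      intro m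
      refine (integral_mono (integrable_mcResidual_sq hf hf2 m)
        (integrable_mcResidual_bound hf hf2 m) fun x => mcResidual_sq_le _ m).trans_eq ?_
      rw [integral_add, integral_const_mul, integral_const_mul,
        integral_mcMean (hf.pow_const 2) hf2.integrable_sq m.succ_ne_zero,
        integral_eval_iidLaw (hf.pow_const 2)]
      · ring
      · exact ((identDistrib_eval_iidLaw (hf.pow_const 2) m).integrable_iff.2
          hf2.integrable_sq).const_mul 2
      · exact (integrable_mcMean (hf.pow_const 2) hf2.integrable_sq (m + 1)).const_mul 2
    simp only [mcVar_eq_sum_mcResidual]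
    rw [integral_div, integral_finsetSum _ fun m _ => integrable_mcResidual_sq hf hf2 m,
      div_le_iff₀ (by linarith)]
    refine (Finset.sum_le_sum fun m _ => hres m).trans ?_
    rw [Finset.sum_const, Finset.card_range, nsmul_eq_mul]
    nlinarith

lemma memLp_normalizedError (hf : Measurable f) (hf2 : MemLp f 2 μ) (M : ℕ) :
    MemLp (normalizedError μ f M) 2 (iidLaw μ) :=
  ((memLp_finsetSum _ fun m _ => (identDistrib_eval_iidLaw hf m).memLp_iff.2 hf2).sub
    (memLp_const _)).const_mul _

/-- The second moment of the normalized error is the variance of `f`, which the second moment of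
`f` bounds uniformly in the number of realizations. -/
lemma integral_normalizedError_sq_le (hf : Measurable f) (hf2 : MemLp f 2 μ) (M : ℕ) :
    ∫ x, normalizedError μ f M x ^ 2 ∂iidLaw μ ≤ ∫ y, f y ^ 2 ∂μ := by
  have hL : ∀ m, MemLp (fun x : ℕ → X => f (x m)) 2 (iidLaw μ) :=
    fun m => (identDistrib_eval_iidLaw hf m).memLp_iff.2 hf2
  have hvar : Var[∑ m ∈ Finset.range M, fun x : ℕ → X => f (x m); iidLaw μ] = M * Var[f; μ] := by
    rw [IndepFun.variance_sum (fun m _ => hL m)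
      (fun i _ j _ hij => (iIndepFun_eval_iidLaw hf).indepFun hij)]
    simp_rw [fun m => (identDistrib_eval_iidLaw (μ := μ) hf m).variance_eq]
    simp
  have hmean : ∫ x, (∑ m ∈ Finset.range M, fun x : ℕ → X => f (x m)) x ∂iidLaw μ
      = M * ∫ y, f y ∂μ := by
    simp only [Finset.sum_apply]
    rw [integral_finsetSum _ fun m _ => (hL m).integrable (by norm_num)]
    simp_rw [integral_eval_iidLaw hf]
    simp
  rw [variance_eq_integral (by fun_prop), hmean] at hvar
  simp only [Finset.sum_apply] at hvar
  simp only [normalizedError, mul_pow, integral_const_mul, hvar]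
  have hle : Var[f; μ] ≤ ∫ y, f y ^ 2 ∂μ := variance_le_expectation_sq hf.aestronglyMeasurable
  rcases Nat.eq_zero_or_pos M with rfl | hM
  · simpa using integral_nonneg fun y => sq_nonneg (f y)
  · have hM' : (0 : ℝ) < M := by exact_mod_cast hM
    rw [inv_pow, Real.sq_sqrt hM'.le]
    field_simp
    exact hle

lemma tendstoInMeasure_zero_of_integral_sq {Ω : Type*} [MeasurableSpace Ω] {P : Measure Ω}
    [IsFiniteMeasure P] {h : ℕ → Ω → ℝ} (hi : ∀ n, Integrable (fun ω => h n ω ^ 2) P)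
    (hlim : Tendsto (fun n => ∫ ω, h n ω ^ 2 ∂P) atTop (𝓝 0)) :
    TendstoInMeasure P h atTop 0 := by
  rw [tendstoInMeasure_iff_measureReal_norm]
  intro ε hε
  have h0 : Tendsto (fun n => (∫ ω, h n ω ^ 2 ∂P) / ε ^ 2) atTop (𝓝 0) := by
    simpa using hlim.div_const (ε ^ 2)
  refine squeeze_zero (fun _ => measureReal_nonneg) (fun n => ?_) h0
  rw [le_div_iff₀' (by positivity)]
  refine le_trans (le_of_eq ?_) (mul_meas_ge_le_integral_of_nonneg
    (ae_of_all _ fun ω => sq_nonneg (h n ω)) (hi n) (ε ^ 2))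
  congr 3
  ext ω
  simp only [Pi.zero_apply, sub_zero, Real.norm_eq_abs]
  rw [← sq_abs (h n ω), sq_le_sq₀ hε.le (abs_nonneg _)]

/-- The central limit theorem for the studentized error, locally uniform in the integrand: instead
of one fixed `f` it allows integrands `f n` converging to `f` in `L²`. By the `L²` bounds on
`normalizedError` and `mcVar`, replacing `f n` by `f` only changes the two sides of the inequality
by terms that vanish in probability. -/
theorem tendsto_confidenceEvent {F : ℕ → X → ℝ} {T : ℕ → ℕ} (hF : ∀ n, Measurable (F n))
    (hF2 : ∀ n, MemLp (F n) 2 μ) (hf : Measurable f) (hf2 : MemLp f 2 μ)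
    (hlim : Tendsto (fun n => ∫ y, (F n y - f y) ^ 2 ∂μ) atTop (𝓝 0))
    (hvar : Var[f; μ] ≠ 0) (hT : Tendsto T atTop atTop) {a : ℝ} (ha : 0 < a) :
    Tendsto (fun n => (iidLaw μ).real (confidenceEvent μ (F n) a (T n))) atTop
      (𝓝 (erf (a / √2))) := by
  have hFi := fun n => (hF2 n).integrable (q := 2) (by norm_num)
  have hfi := hf2.integrable (q := 2) (by norm_num)
  set v : NNReal := Var[f; μ].toNNReal with hv
  have hvc : (v : ℝ) = Var[f; μ] := Real.coe_toNNReal _ (variance_nonneg _ _)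
  have hv0 : v ≠ 0 := by
    intro h
    rw [h] at hvc
    exact hvar hvc.symm
  have hclt : TendstoInDistribution (normalizedError μ f) atTop (id : ℝ → ℝ)
      (fun _ => iidLaw μ) (gaussianReal 0 v) := by
    have h := tendstoInDistribution_inv_sqrt_mul_sum_sub (P := iidLaw μ)
      (X := fun m (x : ℕ → X) => f (x m)) (Y := (id : ℝ → ℝ)) (P' := gaussianReal 0 v)
      (by
        rw [(identDistrib_eval_iidLaw hf 0).variance_eq]
        exact HasLaw.id)
      ((identDistrib_eval_iidLaw hf 0).memLp_iff.2 hf2) (iIndepFun_eval_iidLaw hf)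
      (fun i => (identDistrib_eval_iidLaw hf i).trans (identDistrib_eval_iidLaw hf 0).symm)
    rw [integral_eval_iidLaw hf] at h
    exact h
  have hcltT : TendstoInDistribution (fun n => normalizedError μ f (T n)) atTop (id : ℝ → ℝ)
      (fun _ => iidLaw μ) (gaussianReal 0 v) :=
    ⟨fun n => (measurable_normalizedError hf _).aemeasurable, aemeasurable_id,
      hclt.tendsto.comp hT⟩
  have hdiff : ∀ n, Measurable fun y => F n y - f y := fun n => (hF n).sub hf
  have hdiff2 : ∀ n, MemLp (fun y => F n y - f y) 2 μ := fun n => (hF2 n).sub hf2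
  have hcltF : TendstoInDistribution (fun n => normalizedError μ (F n) (T n)) atTop (id : ℝ → ℝ)
      (fun _ => iidLaw μ) (gaussianReal 0 v) := by
    refine tendstoInDistribution_of_tendstoInMeasure_sub _ _ hcltT ?_
      fun n => (measurable_normalizedError (hF n) _).aemeasurable
    have heq : (fun n => normalizedError μ (F n) (T n)) - (fun n => normalizedError μ f (T n))
        = fun n => normalizedError μ (fun y => F n y - f y) (T n) := by
      funext n x
      exact (normalizedError_sub (hFi n) hfi (T n) x).symm
    rw [heq]
    exact tendstoInMeasure_zero_of_integral_sq
      (fun n => (memLp_normalizedError (hdiff n) (hdiff2 n) _).integrable_sq)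
      (squeeze_zero (fun n => integral_nonneg fun _ => sq_nonneg _)
        (fun n => integral_normalizedError_sq_le (hdiff n) (hdiff2 n) _) hlim)
  have hmeasV : ∀ n, AEMeasurable (fun x : ℕ → X => √(mcVar (T n) fun m => F n (x m)))
      (iidLaw μ) := fun n =>
    (measurable_mcVar_comp (x := fun (x : ℕ → X) m => F n (x m))
      (fun m => (hF n).comp (measurable_pi_apply m)) _).sqrt.aemeasurable
  -- the estimated standard deviation is consistent: strong law for `f`, seminorm bound for `F n - f`
  have hsd : TendstoInMeasure (iidLaw μ) (fun n (x : ℕ → X) => √(mcVar (T n) fun m => F n (x m)))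
      atTop (fun _ => √(v : ℝ)) := by
    have h1 : TendstoInMeasure (iidLaw μ) (fun n (x : ℕ → X) => √(mcVar (T n) fun m => f (x m)))
        atTop (fun _ => √(v : ℝ)) := by
      refine tendstoInMeasure_of_tendsto_ae (fun n => ?_) ?_
      · exact (measurable_mcVar_comp (x := fun (x : ℕ → X) m => f (x m))
          (fun m => hf.comp (measurable_pi_apply m)) _).sqrt.aestronglyMeasurable
      · filter_upwards [ae_tendsto_mcVar hf hf2] with x hx
        rw [hvc]
        exact (hx.comp hT).sqrt
    have h2 : TendstoInMeasure (iidLaw μ)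
        (fun n (x : ℕ → X) => √(mcVar (T n) fun m => F n (x m) - f (x m))) atTop 0 := by
      have hsq : ∀ n (x : ℕ → X), √(mcVar (T n) fun m => F n (x m) - f (x m)) ^ 2
          = mcVar (T n) fun m => F n (x m) - f (x m) := fun n x => Real.sq_sqrt (mcVar_nonneg _ _)
      refine tendstoInMeasure_zero_of_integral_sq (fun n => ?_) ?_
      · simp_rw [hsq]
        exact integrable_mcVar (hdiff n) (hdiff2 n) _
      · simp_rw [hsq]
        refine squeeze_zero (fun n => integral_nonneg fun _ => mcVar_nonneg _ _)
          (fun n => integral_mcVar_le (hdiff n) (hdiff2 n) _) ?_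
        simpa using hlim.const_mul 8
    rw [tendstoInMeasure_iff_measureReal_norm] at h1 h2 ⊢
    intro ε hε
    have h12 := (h2 (ε / 2) (half_pos hε)).add (h1 (ε / 2) (half_pos hε))
    rw [add_zero] at h12
    refine squeeze_zero (fun _ => measureReal_nonneg) (fun n => ?_) h12
    refine (measureReal_mono fun x hx => ?_).trans (measureReal_union_le _ _)
    by_contra hcon
    simp only [Set.mem_union, Set.mem_ofPred_eq, not_or, not_le, Pi.zero_apply, sub_zero,
      Real.norm_eq_abs] at hcon hx
    rw [abs_of_nonneg (Real.sqrt_nonneg _)] at hcon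
    have h3 := abs_sqrt_mcVar_sub_le (T n) (fun m => F n (x m)) (fun m => f (x m))
    have h4 := abs_sub_le √(mcVar (T n) fun m => F n (x m)) √(mcVar (T n) fun m => f (x m)) √(v : ℝ)
    linarith [hcon.1, hcon.2]
  -- Slutsky's theorem and the portmanteau theorem; the limit law does not charge the boundary
  have hslutsky := hcltF.continuous_comp_prodMk_of_tendstoInMeasure_const
    (g := fun z : ℝ × ℝ => |z.1| - a * z.2) (by fun_prop) hsd hmeasV
  have hlimset : ((gaussianReal 0 v).map fun z : ℝ => |id z| - a * √(v : ℝ)).real (Set.Iic 0)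
      = erf (a / √2) := by
    rw [map_measureReal_apply (by fun_prop) measurableSet_Iic, ← gaussianReal_real_abs_le hv0 ha]
    congr 1
    ext z
    simp
  have hfront : ((gaussianReal 0 v).map fun z : ℝ => |id z| - a * √(v : ℝ))
      (frontier (Set.Iic 0)) = 0 := by
    have := nullSingletonClass_gaussianReal (μ := 0) hv0
    rw [frontier_Iic, Measure.map_apply (by fun_prop) (measurableSet_singleton 0)]
    refine measure_mono_null (t := {a * √(v : ℝ), -(a * √(v : ℝ))}) (fun z hz => ?_)
      ((Set.toFinite _).measure_zero _)
    have hz' : |z| = a * √(v : ℝ) := by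
      simpa [sub_eq_zero] using hz
    rcases abs_choice z with h | h <;> rw [h] at hz'
    · exact Or.inl hz'
    · exact Or.inr (by simp [← hz'])
  have hport := ProbabilityMeasure.tendsto_measure_of_null_frontier_of_tendsto' hslutsky.tendsto
    (E := Set.Iic 0) hfront
  have hprob : IsProbabilityMeasure ((gaussianReal 0 v).map fun z : ℝ => |id z| - a * √(v : ℝ)) :=
    Measure.isProbabilityMeasure_map (by fun_prop)
  have hne : ((gaussianReal 0 v).map fun z : ℝ => |id z| - a * √(v : ℝ)) (Set.Iic 0) ≠ ⊤ :=
    measure_ne_top _ _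
  have hreal := (ENNReal.tendsto_toReal hne).comp hport
  rw [← hlimset]
  refine hreal.congr' ?_
  filter_upwards [hT.eventually_gt_atTop 0] with n hn
  simp only [Function.comp_apply, ProbabilityMeasure.coe_mk]
  rw [Measure.map_apply_of_aemeasurable, measureReal_def]
  · congr 2
    ext x
    exact (mem_confidenceEvent_iff hn x).symm
  · exact ((measurable_normalizedError (hF n) _).aemeasurable.abs).sub ((hmeasV n).const_mul a)
  · exact measurableSet_Iic

end Iid

/-! ### Conditioning on independent data -/

section Conditioning

variable {Ω β γ : Type*} [MeasurableSpace Ω] [MeasurableSpace β] [MeasurableSpace γ]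
  {P : Measure Ω} [IsProbabilityMeasure P] {Y : Ω → β} {W : Ω → γ} {ν : Measure γ}
  [IsProbabilityMeasure ν] {S : Set (β × γ)}

lemma measurable_measureReal_section (hS : MeasurableSet S) :
    Measurable fun y => ν.real (Prod.mk y ⁻¹' S) :=
  (measurable_measure_prodMk_left hS).ennreal_toReal

/-- Fubini's theorem for an event that depends on two independent random variables, the second one
of law `ν`, and is restricted by a condition on the first one. -/
lemma measureReal_inter_preimage_of_indepFun (hY : Measurable Y) (hW : Measurable W)
    (hν : P.map W = ν) (h : IndepFun Y W P) (hS : MeasurableSet S) {D : Set β}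
    (hD : MeasurableSet D) :
    P.real ({ω | (Y ω, W ω) ∈ S} ∩ Y ⁻¹' D)
      = ∫ ω in Y ⁻¹' D, ν.real (Prod.mk (Y ω) ⁻¹' S) ∂P := by
  have hmap := h.map_prod_eq_prod_map_map hY.aemeasurable hW.aemeasurable
  rw [hν] at hmap
  have hSD : MeasurableSet (S ∩ D ×ˢ Set.univ) := hS.inter (hD.prod MeasurableSet.univ)
  have hset : {ω | (Y ω, W ω) ∈ S} ∩ Y ⁻¹' D
      = (fun ω => (Y ω, W ω)) ⁻¹' (S ∩ D ×ˢ Set.univ) := by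
    ext ω; simp
  have hsec : ∀ y, ν (Prod.mk y ⁻¹' (S ∩ D ×ˢ Set.univ))
      = D.indicator (fun y => ν (Prod.mk y ⁻¹' S)) y := by
    intro y
    by_cases hy : y ∈ D
    · rw [Set.indicator_of_mem hy]
      congr 1
      ext x; simp [hy]
    · rw [Set.indicator_of_notMem hy]
      convert! measure_empty (μ := ν)
      ext x; simp [hy]
  have hmeas := measurable_measure_prodMk_left (ν := ν) hS
  simp only [measureReal_def]
  rw [hset, ← Measure.map_apply (hY.prodMk hW) hSD, hmap, Measure.prod_apply hSD]
  simp_rw [hsec]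
  rw [lintegral_indicator hD, setLIntegral_map hD hmeas hY, integral_toReal]
  · exact (hmeas.comp hY).aemeasurable
  · exact ae_of_all _ fun _ => measure_lt_top _ _

/-- Conditioning on `Y` an event that depends on `Y` and an independent random variable of law `ν`
amounts to freezing the value of `Y`. -/
lemma condExp_indicator_of_indepFun (hY : Measurable Y) (hW : Measurable W)
    (hν : P.map W = ν) (h : IndepFun Y W P) (hS : MeasurableSet S) :
    P⟦{ω | (Y ω, W ω) ∈ S} | MeasurableSpace.comap Y inferInstance⟧
      =ᵐ[P] fun ω => ν.real (Prod.mk (Y ω) ⁻¹' S) := by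
  have hA : MeasurableSet {ω | (Y ω, W ω) ∈ S} := (hY.prodMk hW) hS
  have hg := measurable_measureReal_section (ν := ν) hS
  refine (ae_eq_condExp_of_forall_setIntegral_eq hY.comap_le ?_ ?_ ?_ ?_).symm
  · exact (integrable_const _).indicator hA
  · intro s _ _
    refine (Integrable.of_bound (hg.comp hY).aestronglyMeasurable 1
      (ae_of_all _ fun ω => ?_)).integrableOn
    simp [abs_of_nonneg measureReal_nonneg]
  · rintro s ⟨D, hD, rfl⟩ _
    rw [← measureReal_inter_preimage_of_indepFun hY hW hν h hS hD, integral_indicator_const _ hA,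
      measureReal_restrict_apply hA]
    simp
  · exact (hg.comp (comap_measurable Y)).aestronglyMeasurable

end Conditioning

/-! ### Coverage for control variates with frozen coefficients -/

section ControlVariate

variable {Λ X : Type*} [MeasurableSpace X] {μ : Measure X} [IsProbabilityMeasure μ]
  {Z : Λ → X → ℝ} {I : ℕ} {l : Λ} {lam : Fin I → Λ}

/-- The random variable `Z^l - ∑ i, α i * (Z^{lam i} - c i)` as a function of the input; `rbSample`
lists its realizations. -/
def rbVariable (Z : Λ → X → ℝ) (l : Λ) (lam : Fin I → Λ) (α c : Fin I → ℝ) (x : X) : ℝ :=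
  Z l x - ∑ i, α i * (Z (lam i) x - c i)

lemma measurable_rbVariable (hZm : ∀ k, Measurable (Z k)) (α c : Fin I → ℝ) :
    Measurable (rbVariable Z l lam α c) := by
  unfold rbVariable
  fun_prop

lemma memLp_rbVariable (hZ : ∀ k, MemLp (Z k) 2 μ) (α c : Fin I → ℝ) :
    MemLp (rbVariable Z l lam α c) 2 μ :=
  (hZ l).sub (memLp_finsetSum _ fun i _ => ((hZ (lam i)).sub (memLp_const _)).const_mul _)

lemma integral_rbVariable (hZ : ∀ k, MemLp (Z k) 2 μ) (α c : Fin I → ℝ) :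
    ∫ x, rbVariable Z l lam α c x ∂μ
      = ∫ x, Z l x ∂μ - ∑ i, α i * (∫ x, Z (lam i) x ∂μ - c i) := by
  have hi : ∀ k, Integrable (Z k) μ := fun k => (hZ k).integrable (by norm_num)
  have hi2 : ∀ i, Integrable (fun x => α i * (Z (lam i) x - c i)) μ :=
    fun i => ((hi (lam i)).sub (integrable_const _)).const_mul _
  simp only [rbVariable]
  rw [integral_sub (hi l) (integrable_finsetSum _ fun i _ => hi2 i),
    integral_finsetSum _ fun i _ => hi2 i]
  congr 1
  refine Finset.sum_congr rfl fun i _ => ?_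
  rw [integral_const_mul, integral_sub (hi _) (integrable_const _)]
  simp

/-- The centering constants `c` do not affect the variance. -/
lemma variance_rbVariable (hZm : ∀ k, Measurable (Z k)) (α c : Fin I → ℝ) :
    Var[rbVariable Z l lam α c; μ] = Var[fun x => Z l x - ∑ i, α i * Z (lam i) x; μ] := by
  have h : rbVariable Z l lam α c
      = fun x => (Z l x - ∑ i, α i * Z (lam i) x) + ∑ i, α i * c i := by
    funext x
    simp only [rbVariable, mul_sub, Finset.sum_sub_distrib]
    ring
  rw [h, variance_add_const (by fun_prop)]

lemma continuous_variance_sub_sum (hZ : ∀ k, MemLp (Z k) 2 μ) :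
    Continuous fun α : Fin I → ℝ => Var[fun x => Z l x - ∑ i, α i * Z (lam i) x; μ] := by
  have h : ∀ α : Fin I → ℝ, Var[fun x => Z l x - ∑ i, α i * Z (lam i) x; μ]
      = Var[Z l; μ] - 2 * ∑ i, α i * cov[Z l, Z (lam i); μ]
        + ∑ i, ∑ j, α i * (α j * cov[Z (lam i), Z (lam j); μ]) := by
    intro α
    have h1 : ∀ i, MemLp (fun x => α i * Z (lam i) x) 2 μ := fun i => (hZ (lam i)).const_mul _
    rw [variance_fun_sub (hZ l) (memLp_finsetSum _ fun i _ => h1 i), variance_fun_sum h1,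
      covariance_fun_sum_right h1 (hZ l)]
    simp_rw [covariance_const_mul_left, covariance_const_mul_right]
  simp_rw [h]
  fun_prop

lemma tendsto_integral_rbVariable_sub_sq (hZm : ∀ k, Measurable (Z k))
    (hZ : ∀ k, MemLp (Z k) 2 μ) {α c : ℕ → Fin I → ℝ} {α' c' : Fin I → ℝ}
    (hα : Tendsto α atTop (𝓝 α')) (hc : Tendsto c atTop (𝓝 c')) :
    Tendsto (fun n => ∫ x, (rbVariable Z l lam (α n) (c n) x - rbVariable Z l lam α' c' x) ^ 2 ∂μ)
      atTop (𝓝 0) := by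
  have hαi : ∀ i, Tendsto (fun n => α n i) atTop (𝓝 (α' i)) := tendsto_pi_nhds.1 hα
  have hci : ∀ i, Tendsto (fun n => c n i) atTop (𝓝 (c' i)) := tendsto_pi_nhds.1 hc
  set d : ℕ → ℝ := fun n => ∑ i, α n i * c n i - ∑ i, α' i * c' i with hd
  have hdl : Tendsto d atTop (𝓝 0) := by
    have h1 : Tendsto (fun n => ∑ i, α n i * c n i) atTop (𝓝 (∑ i, α' i * c' i)) :=
      tendsto_finsetSum _ fun i _ => (hαi i).mul (hci i)
    simpa using h1.sub_const (∑ i, α' i * c' i)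
  have hul : ∀ i, Tendsto (fun n => α n i - α' i) atTop (𝓝 0) := fun i => by
    simpa using (hαi i).sub_const (α' i)
  have hdiff : ∀ n x, rbVariable Z l lam (α n) (c n) x - rbVariable Z l lam α' c' x
      = d n - ∑ i, (α n i - α' i) * Z (lam i) x := by
    intro n x
    simp only [rbVariable, hd, mul_sub, sub_mul, Finset.sum_sub_distrib]
    ring
  simp_rw [hdiff]
  have hH2 : MemLp (fun x => (1 : ℝ) + ∑ i, ‖Z (lam i) x‖) 2 μ := by
    have h1 : MemLp (fun x => ∑ i, ‖Z (lam i) x‖) 2 μ :=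
      memLp_finsetSum _ fun i _ => (hZ (lam i)).norm
    have h0 : MemLp (fun _ : X => (1 : ℝ)) 2 μ := memLp_const _
    exact h0.add h1
  have hmeas : ∀ᶠ n in atTop,
      AEStronglyMeasurable (fun x => (d n - ∑ i, (α n i - α' i) * Z (lam i) x) ^ 2) μ :=
    Eventually.of_forall fun n => Measurable.aestronglyMeasurable (by fun_prop)
  have hbound : ∀ᶠ n in atTop,
      ∀ᵐ x ∂μ, ‖(d n - ∑ i, (α n i - α' i) * Z (lam i) x) ^ 2‖ ≤ (1 + ∑ i, ‖Z (lam i) x‖) ^ 2 := by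
    have hd1 : ∀ᶠ n in atTop, |d n| ≤ 1 := by
      have h := hdl.abs
      rw [abs_zero] at h
      exact h.eventually_le_const one_pos
    have hu1 : ∀ᶠ n in atTop, ∀ i, |α n i - α' i| ≤ 1 := by
      rw [eventually_all]
      intro i
      have h := (hul i).abs
      rw [abs_zero] at h
      exact h.eventually_le_const one_pos
    filter_upwards [hd1, hu1] with n hn1 hn2
    refine ae_of_all _ fun x => ?_
    rw [Real.norm_of_nonneg (sq_nonneg _), ← sq_abs]
    refine pow_le_pow_left₀ (abs_nonneg _) ((abs_sub _ _).trans (add_le_add hn1 ?_)) 2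
    refine (Finset.abs_sum_le_sum_abs _ _).trans (Finset.sum_le_sum fun i _ => ?_)
    rw [abs_mul]
    exact mul_le_of_le_one_left (abs_nonneg _) (hn2 i)
  have hpt : ∀ᵐ x ∂μ, Tendsto (fun n => (d n - ∑ i, (α n i - α' i) * Z (lam i) x) ^ 2) atTop
      (𝓝 0) := by
    refine ae_of_all _ fun x => ?_
    have h1 : Tendsto (fun n => d n - ∑ i, (α n i - α' i) * Z (lam i) x) atTop
        (𝓝 (0 - ∑ i, 0 * Z (lam i) x)) :=
      hdl.sub (tendsto_finsetSum _ fun i _ => (hul i).mul_const _)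
    simpa using h1.pow 2
  have hlim := tendsto_integral_filter_of_dominated_convergence (fun x => (1 + ∑ i, ‖Z (lam i) x‖) ^ 2) hmeas hbound
    hH2.integrable_sq hpt
  rwa [integral_zero] at hlim

/-- Coverage of the confidence interval for the controlled variable, uniformly over bounded
coefficients with variance bounded below: by compactness it suffices to treat convergent
coefficients, for which `tendsto_confidenceEvent` applies. -/
theorem tendsto_confidenceEvent_rbVariable (hZm : ∀ k, Measurable (Z k))
    (hZ : ∀ k, MemLp (Z k) 2 μ) {α c : ℕ → Fin I → ℝ} {c' : Fin I → ℝ}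
    (hc : Tendsto c atTop (𝓝 c')) {δ : ℝ} (hδ : 0 < δ) {C : ℝ}
    (hα : ∀ᶠ L in atTop,
      ‖α L‖ ≤ C ∧ δ ≤ Var[fun x => Z l x - ∑ i, α L i * Z (lam i) x; μ])
    {a : ℝ} (ha : 0 < a) :
    Tendsto (fun p : ℕ × ℕ =>
        (iidLaw μ).real (confidenceEvent μ (rbVariable Z l lam (α p.1) (c p.1)) a p.2))
      (atTop ×ˢ atTop) (𝓝 (erf (a / √2))) := by
  refine tendsto_of_subseq_tendsto fun ns hns => ?_
  have hL : Tendsto (fun n => (ns n).1) atTop atTop := tendsto_fst.comp hns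
  have hT : Tendsto (fun n => (ns n).2) atTop atTop := tendsto_snd.comp hns
  have hαn := hL.eventually hα
  obtain ⟨α', -, φ, hφ, hαφ⟩ := tendsto_subseq_of_frequently_bounded
    (Metric.isBounded_closedBall (x := (0 : Fin I → ℝ)) (r := C))
    (x := fun n => α (ns n).1)
    (hαn.mono fun n hn => mem_closedBall_zero_iff.2 hn.1).frequently
  have hvar' : δ ≤ Var[fun x => Z l x - ∑ i, α' i * Z (lam i) x; μ] :=
    ge_of_tendsto (((continuous_variance_sub_sum (l := l) (lam := lam) hZ).tendsto α').comp hαφ)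
      ((hφ.tendsto_atTop.eventually hαn).mono fun n hn => hn.2)
  refine ⟨φ, ?_⟩
  refine tendsto_confidenceEvent (f := rbVariable Z l lam α' c') (T := fun n => (ns (φ n)).2)
    (fun n => measurable_rbVariable hZm _ _) (fun n => memLp_rbVariable hZ _ _)
    (measurable_rbVariable hZm α' c') (memLp_rbVariable hZ α' c') ?_ ?_
    (hT.comp hφ.tendsto_atTop) ha
  · exact tendsto_integral_rbVariable_sub_sq hZm hZ hαφ ((hc.comp hL).comp hφ.tendsto_atTop)
  · rw [variance_rbVariable hZm]
    exact (hδ.trans_le hvar').ne'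

/-- Joint measurability of the confidence event in the means `y.1`, the coefficients `y.2` and the
test inputs. -/
lemma measurableSet_confidenceEvent_rbVariable (hZm : ∀ k, Measurable (Z k))
    (hZ : ∀ k, MemLp (Z k) 2 μ) (a : ℝ) (T : ℕ) :
    MeasurableSet {z : ((Fin I → ℝ) × (Fin I → ℝ)) × (ℕ → X) |
      z.2 ∈ confidenceEvent μ (rbVariable Z l lam z.1.2 z.1.1) a T} := by
  have h0 : ∀ m, Measurable fun z : ((Fin I → ℝ) × (Fin I → ℝ)) × (ℕ → X) =>
      rbVariable Z l lam z.1.2 z.1.1 (z.2 m) := by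
    intro m
    unfold rbVariable
    fun_prop
  have h1 := measurable_mcMean_comp h0 T
  have h2 := measurable_mcVar_comp h0 T
  simp only [confidenceEvent, Set.mem_ofPred_eq, integral_rbVariable hZ]
  exact measurableSet_le (by fun_prop) (by fun_prop)

end ControlVariate

/-! ### Coverage for precomputed coefficients and means -/

/-- Bounded convergence over varying domains of integration: only the measures of the domains have
to converge, since the limit of the integrands is a constant. -/
lemma tendsto_setIntegral_of_ae_tendsto {ι Ω : Type*} [MeasurableSpace Ω] {P : Measure Ω}
    [IsProbabilityMeasure P] {u : Filter ι} [u.IsCountablyGenerated] {F : ι → Ω → ℝ} {e q : ℝ}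
    {B : ι → Set Ω} (hFm : ∀ p, Measurable (F p)) (hF1 : ∀ p ω, |F p ω| ≤ 1)
    (hF : ∀ᵐ ω ∂P, Tendsto (fun p => F p ω) u (𝓝 e))
    (hB : Tendsto (fun p => P.real (B p)) u (𝓝 q)) :
    Tendsto (fun p => ∫ ω in B p, F p ω ∂P) u (𝓝 (e * q)) := by
  have hFint : ∀ p, Integrable (F p) P := fun p =>
    Integrable.of_bound (hFm p).aestronglyMeasurable 1 (ae_of_all _ (hF1 p))
  have hL1 : Tendsto (fun p => ∫ ω, |F p ω - e| ∂P) u (𝓝 0) := by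
    have h1 : ∀ᶠ p in u, AEStronglyMeasurable (fun ω => |F p ω - e|) P :=
      Eventually.of_forall fun p =>
        (continuous_abs.measurable.comp ((hFm p).sub_const _)).aestronglyMeasurable
    have h2 : ∀ᶠ p in u, ∀ᵐ ω ∂P, ‖|F p ω - e|‖ ≤ 1 + |e| :=
      Eventually.of_forall fun p => ae_of_all _ fun ω => by
        rw [Real.norm_eq_abs, abs_abs]
        exact (abs_sub _ _).trans (add_le_add (hF1 p ω) le_rfl)
    have h3 : ∀ᵐ ω ∂P, Tendsto (fun p => |F p ω - e|) u (𝓝 0) := by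
      filter_upwards [hF] with ω hω
      simpa using (hω.sub_const e).abs
    have h4 := tendsto_integral_filter_of_dominated_convergence _ h1 h2 (integrable_const _) h3
    rwa [integral_zero] at h4
  have hdiff : Tendsto (fun p => ∫ ω in B p, (F p ω - e) ∂P) u (𝓝 0) := by
    refine squeeze_zero_norm (fun p => ?_) hL1
    refine (norm_integral_le_integral_norm _).trans ?_
    exact setIntegral_le_integral ((hFint p).sub (integrable_const _)).norm
      (ae_of_all _ fun ω => norm_nonneg _)
  have hsum := hdiff.add (hB.const_mul e)
  rw [zero_add] at hsum
  refine hsum.congr fun p => ?_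
  rw [integral_sub (hFint p).integrableOn (integrable_const _), setIntegral_const, smul_eq_mul]
  ring

section Events

variable {Λ X Ω : Type*} [MeasurableSpace X] {μ : Measure X}
  {Z : Λ → X → ℝ} {I : ℕ} {l : Λ} {lam : Fin I → Λ}

lemma largeEvent_eq_preimage_pi (η : Fin I → ℕ → Ω → X) (b : Fin I → ℝ) (L : ℕ) :
    largeEvent μ Z lam η b L
      = (fun ω i m => η i m ω) ⁻¹'
          (Set.univ.pi fun i => confidenceEvent μ (Z (lam i)) (b i) L) := by
  ext ω
  simp only [largeEvent, Set.mem_preimage, Set.mem_univ_pi, confidenceEvent, Set.mem_ofPred_eq]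
  refine forall_congr' fun i => ?_
  rw [abs_sub_comm]
  rfl

lemma measurable_largeMeans (hZm : ∀ k, Measurable (Z k)) (L : ℕ) :
    Measurable fun h : Fin I → ℕ → X => largeMeans Z lam L h := by
  refine measurable_pi_lambda _ fun i => ?_
  exact measurable_mcMean_comp (x := fun (h : Fin I → ℕ → X) m => Z (lam i) (h i m))
    (fun m => (hZm (lam i)).comp (by fun_prop)) L

lemma testEvent_inter_largeEvent_subset (α : ℕ → Ω → Fin I → ℝ) (η : Fin I → ℕ → Ω → X)
    (ξ : ℕ → Ω → X) (a : ℝ) (b : Fin I → ℝ) (L T : ℕ) :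
    testEvent μ Z l lam α η ξ a L T ∩ largeEvent μ Z lam η b L
      ⊆ boundEvent μ Z l lam α η ξ a b L T := by
  rintro ω ⟨h1, h2⟩
  simp only [testEvent, largeEvent, boundEvent, Set.mem_ofPred_eq] at h1 h2 ⊢
  have h3 : |∑ i, α L ω i *
      ((∫ x, Z (lam i) x ∂μ) - largeMeans Z lam L (fun j m => η j m ω) i)|
      ≤ ∑ i, |α L ω i| * (b i * √(mcVar L (fun m => Z (lam i) (η i m ω)) / (L : ℝ))) := by
    refine (Finset.abs_sum_le_sum_abs _ _).trans (Finset.sum_le_sum fun i _ => ?_)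
    rw [abs_mul]
    exact mul_le_mul_of_nonneg_left (h2 i) (abs_nonneg _)
  refine le_trans ?_ (add_le_add h1 h3)
  refine le_trans (le_of_eq (congrArg _ ?_)) (abs_sub _ _)
  ring

variable [IsProbabilityMeasure μ]

/-- Correcting the bias by `∑ i, α i * E(Ỹ^i)` centers the estimator at its exact mean for frozen
`α` and means, so the test event is the confidence event of `rbVariable`. -/
lemma testEvent_eq_confidenceEvent (hZ : ∀ k, MemLp (Z k) 2 μ) (α : ℕ → Ω → Fin I → ℝ)
    (η : Fin I → ℕ → Ω → X) (ξ : ℕ → Ω → X) (a : ℝ) (L T : ℕ) :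
    testEvent μ Z l lam α η ξ a L T
      = {ω | (fun m => ξ m ω) ∈ confidenceEvent μ
          (rbVariable Z l lam (α L ω) (largeMeans Z lam L fun i m => η i m ω)) a T} := by
  ext ω
  simp only [testEvent, confidenceEvent, Set.mem_ofPred_eq, integral_rbVariable hZ]
  rw [← sub_add]
  rfl

variable [MeasurableSpace Ω] {P : Measure Ω}

/-- The probability of the test confidence event when the precomputed means and the coefficients
are frozen at the values `y.1` and `y.2`. -/
noncomputable def frozenCoverage (μ : Measure X) [IsProbabilityMeasure μ] (Z : Λ → X → ℝ) (l : Λ)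
    (lam : Fin I → Λ) (a : ℝ) (T : ℕ) (y : (Fin I → ℝ) × (Fin I → ℝ)) : ℝ :=
  (iidLaw μ).real (confidenceEvent μ (rbVariable Z l lam y.2 y.1) a T)

lemma measurable_frozenCoverage (hZm : ∀ k, Measurable (Z k))
    (hZ : ∀ k, MemLp (Z k) 2 μ) (a : ℝ) (T : ℕ) :
    Measurable (frozenCoverage μ Z l lam a T) := by
  have h := measurableSet_confidenceEvent_rbVariable (μ := μ) (l := l) (lam := lam) hZm hZ a T
  exact measurable_measureReal_section h

lemma map_eq_iidLaw {ξ : ℕ → Ω → X} (hm : ∀ m, Measurable (ξ m)) (hlaw : ∀ m, P.map (ξ m) = μ)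
    (h : iIndepFun ξ P) : P.map (fun ω m => ξ m ω) = iidLaw μ := by
  rw [h.map_fun_eq_infinitePi_map hm]
  simp_rw [hlaw]

lemma map_eq_pi_iidLaw {η : Fin I → ℕ → Ω → X} (hm : ∀ i m, Measurable (η i m))
    (hlaw : ∀ i m, P.map (η i m) = μ) (h : iIndepFun (fun q : Fin I × ℕ => η q.1 q.2) P) :
    P.map (fun ω i m => η i m ω) = Measure.pi fun _ : Fin I => iidLaw μ := by
  have h1 := h.map_fun_eq_infinitePi_map fun q : Fin I × ℕ => hm q.1 q.2
  simp_rw [hlaw] at h1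
  have h2 := Measure.infinitePi_map_curry (ι := Fin I) (κ := ℕ) (fun _ _ => μ)
  rw [← h1, Measure.map_map (by fun_prop) (by fun_prop)] at h2
  rw [← Measure.infinitePi_eq_pi, ← h2]
  rfl

lemma ae_tendsto_largeMeans (hZm : ∀ k, Measurable (Z k)) (hZ : ∀ k, MemLp (Z k) 2 μ)
    {η : Fin I → ℕ → Ω → X} (hm : ∀ i m, Measurable (η i m))
    (hlaw : ∀ i m, P.map (η i m) = μ) (h : iIndepFun (fun q : Fin I × ℕ => η q.1 q.2) P) :
    ∀ᵐ ω ∂P, Tendsto (fun L => largeMeans Z lam L fun i m => η i m ω) atTop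
      (𝓝 fun i => ∫ x, Z (lam i) x ∂μ) := by
  simp_rw [tendsto_pi_nhds]
  rw [ae_all_iff]
  intro i
  have hi : iIndepFun (η i) P :=
    h.precomp (g := fun m => (i, m)) fun _ _ hmn => (Prod.mk.inj hmn).2
  have h1 := ae_tendsto_mcMean (hZm (lam i)) ((hZ (lam i)).integrable (by norm_num))
  rw [← map_eq_iidLaw (hm i) (hlaw i) hi] at h1
  exact ae_of_ae_map (measurable_pi_lambda _ (hm i)).aemeasurable h1

/-- The samples for different `i` are independent, so the probability is a product of probabilities
of confidence events, each of a fixed random variable. -/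
lemma tendsto_measureReal_largeEvent (hZm : ∀ k, Measurable (Z k)) (hZ : ∀ k, MemLp (Z k) 2 μ)
    {η : Fin I → ℕ → Ω → X} (hm : ∀ i m, Measurable (η i m))
    (hlaw : ∀ i m, P.map (η i m) = μ) (h : iIndepFun (fun q : Fin I × ℕ => η q.1 q.2) P)
    (hvar : ∀ i, Var[Z (lam i); μ] ≠ 0) {b : Fin I → ℝ} (hb : ∀ i, 0 < b i) :
    Tendsto (fun L => P.real (largeEvent μ Z lam η b L)) atTop (𝓝 (∏ i, erf (b i / √2))) := by
  have hprod : ∀ L, P.real (largeEvent μ Z lam η b L)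
      = ∏ i, (iidLaw μ).real (confidenceEvent μ (Z (lam i)) (b i) L) := by
    intro L
    rw [largeEvent_eq_preimage_pi, measureReal_def, ← Measure.map_apply (by fun_prop)
      (MeasurableSet.univ_pi fun i => measurableSet_confidenceEvent (hZm (lam i)) (b i) L),
      map_eq_pi_iidLaw hm hlaw h, Measure.pi_pi, ENNReal.toReal_prod]
    rfl
  simp_rw [hprod]
  refine tendsto_finsetProd _ fun i _ => ?_
  exact tendsto_confidenceEvent (T := id) (fun _ => hZm (lam i)) (fun _ => hZ (lam i))
    (hZm (lam i)) (hZ (lam i)) (by simp) (hvar i) tendsto_id (hb i)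

end Events

theorem mainTheorem3 {Λ X Ω : Type*} [MeasurableSpace X] [MeasurableSpace Ω]
    -- the law of the random input and the parametrized square-integrable random variables
    (μ : Measure X) [IsProbabilityMeasure μ] (Z : Λ → X → ℝ)
    (hZmeas : ∀ l, Measurable (Z l)) (hZ : ∀ l, MemLp (Z l) 2 μ)
    (I : ℕ) (l : Λ) (lam : Fin I → Λ)
    -- the probability space that carries all the Monte Carlo realizations
    (P : Measure Ω) [IsProbabilityMeasure P]
    -- test realizations: i.i.d. with law `μ`
    (ξ : ℕ → Ω → X) (hξmeas : ∀ m, Measurable (ξ m)) (hξlaw : ∀ m, P.map (ξ m) = μ)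
    (hξ : iIndepFun ξ P)
    -- large samples: i.i.d. with law `μ`, one independent sample for each `i`
    (η : Fin I → ℕ → Ω → X) (hηmeas : ∀ i m, Measurable (η i m))
    (hηlaw : ∀ i m, P.map (η i m) = μ)
    (hη : iIndepFun (fun q : Fin I × ℕ => η q.1 q.2) P)
    -- the coefficients, which may depend on the large samples but not on the test realizations
    (α : ℕ → Ω → Fin I → ℝ) (hαmeas : ∀ L, Measurable (α L))
    (hindep : IndepFun (fun ω => ((fun L => α L ω), (fun i m => η i m ω)))
      (fun ω m => ξ m ω) P)
    -- non-degeneracy of the variances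
    (hαvar : ∀ᵐ ω ∂P, ∃ c > (0 : ℝ), ∃ C : ℝ, ∀ᶠ L in atTop,
      ‖α L ω‖ ≤ C ∧ c ≤ Var[fun x => Z l x - ∑ i, α L ω i * Z (lam i) x; μ])
    (hlamvar : ∀ i, Var[Z (lam i); μ] ≠ 0)
    (a : ℝ) (ha : 0 < a) (b : Fin I → ℝ) (hb : ∀ i, 0 < b i) :
    (∀ᵐ ω ∂P, Tendsto
      (fun p : ℕ × ℕ =>
        (P⟦testEvent μ Z l lam α η ξ a p.1 p.2 | precomputedSigma Z lam α η p.1⟧) ω)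
      largeGeTest (𝓝 (erf (a / Real.sqrt 2)))) ∧
    Tendsto
      (fun p : ℕ × ℕ =>
        P.real (testEvent μ Z l lam α η ξ a p.1 p.2 ∩ largeEvent μ Z lam η b p.1))
      largeGeTest (𝓝 (erf (a / Real.sqrt 2) * ∏ i, erf (b i / Real.sqrt 2))) ∧
    (∀ L T : ℕ, testEvent μ Z l lam α η ξ a L T ∩ largeEvent μ Z lam η b L
      ⊆ boundEvent μ Z l lam α η ξ a b L T) ∧
    (∀ ε > (0 : ℝ), ∀ᶠ p : ℕ × ℕ in largeGeTest,
      erf (a / Real.sqrt 2) * ∏ i, erf (b i / Real.sqrt 2) - ε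
        ≤ P.real (boundEvent μ Z l lam α η ξ a b p.1 p.2)) := by
  have hsub := testEvent_inter_largeEvent_subset (μ := μ) (Z := Z) (l := l) (lam := lam) α η ξ a b
  have hfilter : largeGeTest ≤ atTop ×ˢ atTop := inf_le_left
  have hgen : largeGeTest.IsCountablyGenerated := by
    unfold largeGeTest
    infer_instance
  have hξm : Measurable fun ω m => ξ m ω := measurable_pi_lambda _ hξmeas
  have hηm : Measurable fun ω i m => η i m ω := by fun_prop
  have hξiid := map_eq_iidLaw hξmeas hξlaw hξ
  have hcm : ∀ L, Measurable fun ω => largeMeans Z lam L fun i m => η i m ω :=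
    fun L => (measurable_largeMeans hZmeas L).comp hηm
  -- the coverage probability with the precomputed data frozen at their values at `ω`
  obtain ⟨F, hF⟩ : ∃ F : ℕ × ℕ → Ω → ℝ, ∀ p ω, F p ω = frozenCoverage μ Z l lam a p.2
      (largeMeans Z lam p.1 (fun i m => η i m ω), α p.1 ω) := ⟨_, fun _ _ => rfl⟩
  have hS := fun T => measurableSet_confidenceEvent_rbVariable (l := l) (lam := lam) hZmeas hZ a T
  have hFm : ∀ p, Measurable (F p) := by
    intro p
    rw [funext (hF p)]
    exact (measurable_frozenCoverage hZmeas hZ a p.2).comp ((hcm p.1).prodMk (hαmeas p.1))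
  have hFlim : ∀ᵐ ω ∂P, Tendsto (fun p => F p ω) largeGeTest (𝓝 (erf (a / √2))) := by
    filter_upwards [hαvar, ae_tendsto_largeMeans (lam := lam) hZmeas hZ hηmeas hηlaw hη]
      with ω ⟨δ, hδ, C, hC⟩ hcω
    simp_rw [hF]
    -- the limit exists along all pairs `(L, T)`, hence along `largeGeTest`
    exact (tendsto_confidenceEvent_rbVariable hZmeas hZ hcω hδ hC ha).mono_left hfilter
  have hcond : ∀ p : ℕ × ℕ,
      P⟦testEvent μ Z l lam α η ξ a p.1 p.2 | precomputedSigma Z lam α η p.1⟧ =ᵐ[P] F p := by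
    intro p
    rw [testEvent_eq_confidenceEvent hZ, funext (hF p)]
    refine condExp_indicator_of_indepFun
      (Y := fun ω => (largeMeans Z lam p.1 (fun i m => η i m ω), α p.1 ω))
      ((hcm p.1).prodMk (hαmeas p.1)) hξm hξiid ?_ (hS p.2)
    exact hindep.comp (φ := fun y : (ℕ → Fin I → ℝ) × (Fin I → ℕ → X) =>
      (largeMeans Z lam p.1 y.2, y.1 p.1)) (ψ := id)
      (((measurable_largeMeans hZmeas p.1).comp measurable_snd).prodMk (by fun_prop))
      measurable_id
  have hBm : ∀ L, MeasurableSet (Set.univ.pi fun i => confidenceEvent μ (Z (lam i)) (b i) L) :=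
    fun L => MeasurableSet.univ_pi fun i => measurableSet_confidenceEvent (hZmeas (lam i)) (b i) L
  -- here the whole large samples are frozen, since `largeEvent` is not a function of their means
  have hinter : ∀ p : ℕ × ℕ,
      P.real (testEvent μ Z l lam α η ξ a p.1 p.2 ∩ largeEvent μ Z lam η b p.1)
        = ∫ ω in largeEvent μ Z lam η b p.1, F p ω ∂P := by
    intro p
    have hφ : Measurable fun z : ((ℕ → Fin I → ℝ) × (Fin I → ℕ → X)) × (ℕ → X) =>
        ((largeMeans Z lam p.1 z.1.2, z.1.1 p.1), z.2) :=
      (((measurable_largeMeans hZmeas p.1).comp (by fun_prop)).prodMk (by fun_prop)).prodMk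
        measurable_snd
    have h := measureReal_inter_preimage_of_indepFun
      (Y := fun ω => ((fun L => α L ω), (fun i m => η i m ω)))
      ((measurable_pi_lambda _ hαmeas).prodMk hηm) hξm hξiid hindep (hφ (hS p.2))
      (D := Prod.snd ⁻¹' (Set.univ.pi fun i => confidenceEvent μ (Z (lam i)) (b i) p.1))
      (measurable_snd (hBm p.1))
    rw [testEvent_eq_confidenceEvent hZ, largeEvent_eq_preimage_pi, funext (hF p)]
    exact h
  have hmain : Tendsto (fun p : ℕ × ℕ =>
      P.real (testEvent μ Z l lam α η ξ a p.1 p.2 ∩ largeEvent μ Z lam η b p.1))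
      largeGeTest (𝓝 (erf (a / √2) * ∏ i, erf (b i / √2))) := by
    have hB : Tendsto (fun p : ℕ × ℕ => P.real (largeEvent μ Z lam η b p.1)) largeGeTest
        (𝓝 (∏ i, erf (b i / √2))) :=
      (tendsto_measureReal_largeEvent hZmeas hZ hηmeas hηlaw hη hlamvar hb).comp
        (tendsto_fst.mono_left hfilter)
    simp_rw [hinter]
    refine tendsto_setIntegral_of_ae_tendsto hFm (fun p ω => ?_) hFlim hB
    rw [hF, frozenCoverage, abs_of_nonneg measureReal_nonneg]
    exact measureReal_le_one
  refine ⟨?_, hmain, hsub, fun ε hε => ?_⟩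
  · have hall : ∀ᵐ ω ∂P, ∀ p : ℕ × ℕ,
        (P⟦testEvent μ Z l lam α η ξ a p.1 p.2 | precomputedSigma Z lam α η p.1⟧) ω = F p ω :=
      ae_all_iff.2 hcond
    filter_upwards [hall, hFlim] with ω h1 h2
    simp_rw [h1]
    exact h2
  · filter_upwards [hmain.eventually_const_le (sub_lt_self _ hε)] with p hp
    exact hp.trans (measureReal_mono (hsub p.1 p.2))
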